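/- Let $d\ge 0$ and let $\mathbb C[[x]]=\mathbb C[[x_1,\dots,x_d]]$. A formal self-map of $(\mathbb C^d,0)$ is a $d$-tuple $F=(F_1,\dots,F_d)$ of formal series without free terms, and $F^*f=f\circ F$ for $f\in\mathbb C[[x]]$; let $\mathrm{Diff}[[\mathbb C^d,0]]$ be the group of invertible formal self-maps under composition. A formal vector field $v$ is a $d$-tuple of formal series without free terms; its formal flow is the one-parametric subgroup $\{e^{tv}:t\in\mathbb C\}\subset\mathrm{Diff}[[\mathbb C^d,0]]$ (that is, $e^{(s+t)v}=e^{sv}\circ e^{tv}$) with $\frac{d}{dt}e^{tv}\big|_{t=0}=v$, the derivative being taken coefficient by coefficient. A subgroup $G\subset\mathrm{Diff}[[\mathbb C^d,0]]$ is called finitely generated if there are finitely many $F_1,\dots,F_p\in\mathrm{Diff}[[\mathbb C^d,0]]$ and finitely many formal vector fields $v_1,\dots,v_q$ ($p,q\ge 0$) such that $G$ is generated as a group by $F_1,\dots,F_p$ and all the maps $e^{tv_k}$, $t\in\mathbb C$, $k=1,\dots,q$. A formal subvariety $X$ is given by a radical ideal $I_X\subset\mathbb C[[x]]$; the preimage $g^{-1}(X)$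 of $X$ by $g\in\mathrm{Diff}[[\mathbb C^d,0]]$ is given by the ideal $g^*I_X$; and the intersection multiplicity of two formal subvarieties is $\mu(X,Y)=\dim_{\mathbb C}\mathbb C[[x]]/(I_X+I_Y)\in\mathbb N\cup\{+\infty\}$. **Theorem.** Let $G\subset\mathrm{Diff}[[\mathbb C^d,0]]$ be a commutative finitely generated subgroup. Then for any two formal subvarieties $X,Y$ there exists a finite constant $m\in\mathbb N$, depending on $G$, $X$ and $Y$, such that for all $g\in G$ $$\mu(g^{-1}(X),Y)<+\infty\implies \mu(g^{-1}(X),Y)\le m.$$ -/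

import Mathlib

noncomputable section

/-- A formal self-map of `(ℂ^d, 0)`: a `d`-tuple of formal series in `d` variables
without free terms. -/
@[ext]
structure FormalSelfMap (d : ℕ) where
  /-- the components of the map -/
  comp : Fin d → MvPowerSeries (Fin d) ℂ
  constantCoeff_comp : ∀ i, MvPowerSeries.constantCoeff (comp i) = 0

namespace FormalSelfMap

variable {d : ℕ}

theorem hasSubst (F : FormalSelfMap d) : MvPowerSeries.HasSubst F.comp :=
  MvPowerSeries.hasSubst_of_constantCoeff_zero F.constantCoeff_comp

/-- The composition operator `F^* : f ↦ f ∘ F` on `ℂ[[x₁, …, x_d]]`. -/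
def pullback (F : FormalSelfMap d) :
    MvPowerSeries (Fin d) ℂ →ₐ[ℂ] MvPowerSeries (Fin d) ℂ :=
  MvPowerSeries.substAlgHom F.hasSubst

theorem pullback_apply (F : FormalSelfMap d) (f : MvPowerSeries (Fin d) ℂ) :
    F.pullback f = MvPowerSeries.subst F.comp f :=
  MvPowerSeries.substAlgHom_apply F.hasSubst f

/-- The identity map. -/
instance : One (FormalSelfMap d) where
  one := ⟨fun i => MvPowerSeries.X i, fun i => MvPowerSeries.constantCoeff_X i⟩

/-- The product `F * G` is the composition `F ∘ G`, with components `Fᵢ(G₁(x), …, G_d(x))`. -/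
instance : Mul (FormalSelfMap d) where
  mul F G := ⟨fun i => G.pullback (F.comp i), fun i => by
    rw [pullback_apply]
    exact MvPowerSeries.constantCoeff_subst_eq_zero G.hasSubst G.constantCoeff_comp
      (F.constantCoeff_comp i)⟩

theorem one_comp (i : Fin d) : (1 : FormalSelfMap d).comp i = MvPowerSeries.X i := rfl

theorem mul_comp (F G : FormalSelfMap d) (i : Fin d) :
    (F * G).comp i = G.pullback (F.comp i) := rfl

theorem pullback_one (f : MvPowerSeries (Fin d) ℂ) :
    (1 : FormalSelfMap d).pullback f = f := by
  rw [pullback_apply]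
  exact congrFun MvPowerSeries.subst_self f

theorem pullback_mul (F G : FormalSelfMap d) (f : MvPowerSeries (Fin d) ℂ) :
    (F * G).pullback f = G.pullback (F.pullback f) := by
  simp only [pullback_apply]
  rw [MvPowerSeries.subst_comp_subst_apply F.hasSubst G.hasSubst]
  congr 1
  funext i
  rw [mul_comp, pullback_apply]

/-- Formal self-maps form a monoid under composition. -/
instance : Monoid (FormalSelfMap d) where
  mul_assoc F G H := by
    ext1
    funext i
    simp only [mul_comp, pullback_mul]
  one_mul F := by
    ext1
    funext i
    rw [mul_comp, one_comp, pullback_apply, MvPowerSeries.subst_X F.hasSubst]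
  mul_one F := by
    ext1
    funext i
    rw [mul_comp, pullback_one]

end FormalSelfMap

/-- The group of invertible formal self-maps of `(ℂ^d, 0)` under composition. -/
abbrev FormalDiff (d : ℕ) : Type := (FormalSelfMap d)ˣ

/-- The composition operator `g^* : f ↦ f ∘ g` of an invertible formal self-map, as an
automorphism of the algebra `ℂ[[x₁, …, x_d]]`. -/
def FormalDiff.pullbackEquiv {d : ℕ} (g : FormalDiff d) :
    MvPowerSeries (Fin d) ℂ ≃ₐ[ℂ] MvPowerSeries (Fin d) ℂ :=
  AlgEquiv.ofAlgHom (FormalSelfMap.pullback g.val) (FormalSelfMap.pullback g.inv)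
    (by
      apply AlgHom.ext
      intro f
      rw [AlgHom.comp_apply, ← FormalSelfMap.pullback_mul, g.inv_val,
        FormalSelfMap.pullback_one, AlgHom.id_apply])
    (by
      apply AlgHom.ext
      intro f
      rw [AlgHom.comp_apply, ← FormalSelfMap.pullback_mul, g.val_inv,
        FormalSelfMap.pullback_one, AlgHom.id_apply])

/-- A formal vector field on `(ℂ^d, 0)` with a singular point at the origin: a `d`-tuple of
formal series without free terms. -/
structure FormalVectorField (d : ℕ) where
  /-- the components of the field -/
  comp : Fin d → MvPowerSeries (Fin d) ℂ
  constantCoeff_comp : ∀ i, MvPowerSeries.constantCoeff (comp i) = 0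

/-- `φ` is the formal flow `t ↦ e^{tv}` of the formal vector field `v`: a one-parametric subgroup
`{φ t : t ∈ ℂ}` of invertible formal self-maps with `d/dt φ t = v` at `t = 0`, where the derivative
is taken coefficient by coefficient. -/
def IsFormalFlow {d : ℕ} (v : FormalVectorField d) (φ : Multiplicative ℂ →* FormalDiff d) : Prop :=
  ∀ (i : Fin d) (n : Fin d →₀ ℕ),
    HasDerivAt (fun t : ℂ => MvPowerSeries.coeff n ((φ (Multiplicative.ofAdd t)).val.comp i))
      (MvPowerSeries.coeff n (v.comp i)) 0

/-- The subgroup `G` is generated by finitely many invertible formal self-maps `F₁, …, F_p` and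
by the flows `e^{tv₁}, …, e^{tv_q}`, `t ∈ ℂ`, of finitely many formal vector fields. -/
def IsFinitelyGeneratedByMapsAndFlows {d : ℕ} (G : Subgroup (FormalDiff d)) : Prop :=
  ∃ (p q : ℕ) (F : Fin p → FormalDiff d) (v : Fin q → FormalVectorField d)
    (φ : Fin q → Multiplicative ℂ →* FormalDiff d),
    (∀ k, IsFormalFlow (v k) (φ k)) ∧
    G = Subgroup.closure (Set.range F ∪ ⋃ k, Set.range (φ k))

/-- A formal subvariety of `(ℂ^d, 0)`, identified with a radical ideal of `ℂ[[x₁, …, x_d]]`. -/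
structure FormalSubvariety (d : ℕ) where
  /-- the ideal of the subvariety -/
  ideal : Ideal (MvPowerSeries (Fin d) ℂ)
  isRadical : ideal.IsRadical

/-- The preimage `g⁻¹(X)`, given by the ideal `g^* I_X`. -/
def FormalSubvariety.preimage {d : ℕ} (g : FormalDiff d) (X : FormalSubvariety d) :
    FormalSubvariety d where
  ideal := X.ideal.map g.pullbackEquiv
  isRadical := by
    intro f hf
    obtain ⟨n, hn⟩ := hf
    obtain ⟨a, ha, hab⟩ := (Ideal.mem_map_of_equiv g.pullbackEquiv (f ^ n)).1 hn
    refine (Ideal.mem_map_of_equiv g.pullbackEquiv f).2 ⟨g.pullbackEquiv.symm f, ?_, by simp⟩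
    refine X.isRadical ⟨n, ?_⟩
    rw [← map_pow, ← hab, AlgEquiv.symm_apply_apply]
    exact ha

/-- The intersection multiplicity `μ(X, Y) = codim_ℂ ⟨I_X, I_Y⟩ ∈ ℕ ∪ {∞}`. -/
def intersectionMultiplicity {d : ℕ} (X Y : FormalSubvariety d) : ℕ∞ :=
  Cardinal.toENat (Module.rank ℂ (MvPowerSeries (Fin d) ℂ ⧸ (X.ideal ⊔ Y.ideal)))

end

/-! Commutativity makes $G$ the image of a homomorphism from $\Lambda=\mathbb Z^p\times\mathbb C^q$.
The key fact is that all coefficients of all series $g^*f$, as functions on $\Lambda$, lie in one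
finitely generated, hence Noetherian, algebra $R$. The condition $\mu(g^{-1}(X),Y)\le k$ is open in
the Zariski topology defined by $R$, so the loci $\{\mu>k\}$ are closed, decrease with $k$ and
stabilize at some $m$; then $\mu>m$ forces $\mu=\infty$.

Openness: by Nakayama, having codimension at most $k$ is visible on $k$-jets
(`rank_quotient_le_iff`). There it is a lower bound for the rank of a system of vectors with entries
in $R$, and a nonzero minor guarantees it (`IsRegularFamily.exists_mem_of_multiplicity_le`).

Finite generation: let $\mathfrak m$ be the maximal ideal. Products of generalized eigenvectors of
$F^*$ are again generalized eigenvectors, so the eigenvalues of $F^*$ on every $\mathbb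
C[[x]]/\mathfrak m^k$ lie in the multiplicative group generated by the finitely many eigenvalues on
$\mathbb C[[x]]/\mathfrak m^2$ (`IsTwistedLeibniz.killedMod`). The coefficients of $F^k$ therefore
solve iterated first-order recurrences and are combinations of sequences $u^kk^j$ with $u$ in this
group. For flows the Lie derivative replaces $F^*$, an additive group replaces the multiplicative
one, and the functions are $e^{st}t^j$. The generators of $R$ do not depend on the jet order. -/

open MvPowerSeries

/-! ### Powers of the maximal ideal and Nakayama's lemma -/

/-- The maximal ideal of `ℂ[[x₁, …, x_d]]`: the series without free term. -/
noncomputable def maxIdeal (d : ℕ) : Ideal (MvPowerSeries (Fin d) ℂ) :=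
  RingHom.ker (constantCoeff (σ := Fin d) (R := ℂ))

theorem mem_maxIdeal {d : ℕ} {f : MvPowerSeries (Fin d) ℂ} :
    f ∈ maxIdeal d ↔ constantCoeff f = 0 := Iff.rfl

/-- The part of a series consisting of monomials whose first variable is `x_i`, divided by `x_i`. -/
noncomputable def firstVarQuotient {d : ℕ} (i : Fin d) (f : MvPowerSeries (Fin d) ℂ) :
    MvPowerSeries (Fin d) ℂ := by
  classical exact fun n => if ∀ l < i, n l = 0 then coeff (n + Finsupp.single i 1) f else 0

/-- Each nonconstant monomial is assigned to the least variable dividing it, so exactly one summand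
contributes to each coefficient. -/
theorem sum_X_mul_firstVarQuotient {d : ℕ} {f : MvPowerSeries (Fin d) ℂ}
    (hf : constantCoeff f = 0) : ∑ i, X i * firstVarQuotient i f = f := by
  classical
  ext n
  rw [map_sum]
  simp only [X_def, coeff_monomial_mul, one_mul]
  by_cases hn : n = 0
  · subst hn
    rw [coeff_zero_eq_constantCoeff_apply, hf]
    refine Finset.sum_eq_zero fun i _ => if_neg fun h => ?_
    simpa using h i
  · have hex : ∃ i : Fin d, n i ≠ 0 := by
      by_contra! h
      exact hn (Finsupp.ext h)
    obtain ⟨i, hi, hmin⟩ : ∃ i : Fin d, n i ≠ 0 ∧ ∀ l < i, n l = 0 := by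
      refine ⟨WellFounded.min wellFounded_lt {i | n i ≠ 0} hex,
        WellFounded.min_mem wellFounded_lt {i | n i ≠ 0} hex, fun l hl => ?_⟩
      by_contra h
      exact WellFounded.not_lt_min wellFounded_lt {i | n i ≠ 0} h hl
    have hle : ∀ l : Fin d, Finsupp.single l 1 ≤ n ↔ n l ≠ 0 := fun l => by
      rw [Finsupp.single_le_iff]; omega
    rw [Finset.sum_eq_single i]
    · rw [if_pos ((hle i).2 hi)]
      change (if ∀ l < i, (n - Finsupp.single i 1 : Fin d →₀ ℕ) l = 0 then _ else _) = _
      rw [if_pos, tsub_add_cancel_of_le ((hle i).2 hi)]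
      intro l hl
      simp [hmin l hl]
    · intro l _ hl
      by_cases hnl : n l = 0
      · rw [if_neg (by rw [hle]; simpa using hnl)]
      · rw [if_pos ((hle l).2 hnl)]
        change (if ∀ l' < l, (n - Finsupp.single l 1 : Fin d →₀ ℕ) l' = 0 then _ else _) = _
        rw [if_neg]
        intro h
        have hil : i < l := lt_of_le_of_ne (not_lt.1 fun h' => hnl (hmin l h')) (Ne.symm hl)
        have := h i hil
        rw [Finsupp.tsub_apply, Finsupp.single_eq_of_ne hil.ne] at this
        exact hi (by simpa using this)
    · simp

theorem mem_maxIdeal_pow {d j : ℕ} {f : MvPowerSeries (Fin d) ℂ} :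
    f ∈ maxIdeal d ^ j ↔ ∀ n : Fin d →₀ ℕ, n.degree < j → coeff n f = 0 := by
  constructor
  · intro hf
    suffices h : (j : ℕ∞) ≤ f.order from fun n hn =>
      coeff_of_lt_order (lt_of_lt_of_le (by exact_mod_cast hn) h)
    induction j generalizing f with
    | zero => simp
    | succ j ih =>
      rw [pow_succ] at hf
      refine Submodule.mul_induction_on hf (fun a ha b hb => ?_) fun a b ha hb => ?_
      · push_cast
        exact (add_le_add (ih ha) (one_le_order_iff_constCoeff_eq_zero.2 hb)).trans le_order_mul
      · exact (le_min ha hb).trans min_order_le_add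
  · intro hf
    induction j generalizing f with
    | zero => simp
    | succ j ih =>
      have h0 : constantCoeff f = 0 := by
        rw [← coeff_zero_eq_constantCoeff_apply]
        exact hf 0 (by simp)
      rw [← sum_X_mul_firstVarQuotient h0, pow_succ']
      refine Ideal.sum_mem _ fun i _ => Ideal.mul_mem_mul (constantCoeff_X i) (ih fun n hn => ?_)
      change (if ∀ l < i, n l = 0 then _ else _) = (0 : ℂ)
      split_ifs
      · exact hf _ (by rw [map_add, Finsupp.degree_single]; omega)
      · rfl

theorem maxIdeal_fg (d : ℕ) : (maxIdeal d).FG := by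
  classical
  refine ⟨Finset.univ.image (fun i => (X i : MvPowerSeries (Fin d) ℂ)), le_antisymm ?_ ?_⟩
  · rw [Ideal.span_le]
    intro f hf
    obtain ⟨i, -, rfl⟩ := Finset.mem_image.1 (Finset.mem_coe.1 hf)
    exact constantCoeff_X i
  · intro f hf
    rw [← sum_X_mul_firstVarQuotient hf]
    exact Ideal.sum_mem _ fun i _ => Ideal.mul_mem_right _ _ (Ideal.subset_span (by simp))

theorem maxIdeal_le_jacobson (d : ℕ) : maxIdeal d ≤ Ideal.jacobson ⊥ := by
  intro f hf
  rw [Ideal.mem_jacobson_bot]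
  intro g
  rw [isUnit_iff_constantCoeff, map_add, map_mul, mem_maxIdeal.1 hf]
  simp

/-- Nakayama's lemma for the finitely generated ideal $\mathfrak m^j$, with $\mathfrak m$ inside the
Jacobson radical. -/
theorem pow_maxIdeal_le_of_le_sup {d j : ℕ} {I : Ideal (MvPowerSeries (Fin d) ℂ)}
    (h : maxIdeal d ^ j ≤ I ⊔ maxIdeal d ^ (j + 1)) : maxIdeal d ^ j ≤ I := by
  refine Submodule.le_of_le_smul_of_le_jacobson_bot (I := maxIdeal d) ((maxIdeal_fg d).pow)
    (maxIdeal_le_jacobson d) ?_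
  rwa [smul_eq_mul, ← pow_succ']

/-! ### Jets and codimension of ideals -/

/-- The exponents of the monomials of degree at most `k`. -/
abbrev Exponents (d k : ℕ) : Type := {n : Fin d →₀ ℕ // n.degree ≤ k}

noncomputable instance (d k : ℕ) : Fintype (Exponents d k) :=
  (Finsupp.finite_of_degree_le k).fintype

/-- The `k`-jet of a series. -/
noncomputable def jet (d k : ℕ) : MvPowerSeries (Fin d) ℂ →ₗ[ℂ] (Exponents d k → ℂ) :=
  LinearMap.pi fun n => coeff n.1

theorem jet_apply {d k : ℕ} (f : MvPowerSeries (Fin d) ℂ) (n : Exponents d k) :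
    jet d k f n = coeff n.1 f := rfl

theorem jet_eq_zero {d k : ℕ} {f : MvPowerSeries (Fin d) ℂ} :
    jet d k f = 0 ↔ f ∈ maxIdeal d ^ (k + 1) := by
  rw [mem_maxIdeal_pow]
  exact ⟨fun h n hn => congrFun h ⟨n, Nat.lt_succ_iff.1 hn⟩,
    fun h => funext fun n => h n.1 (Nat.lt_succ_iff.2 n.2)⟩

theorem jet_surjective (d k : ℕ) : Function.Surjective (jet d k) := by
  intro v
  refine ⟨fun n => if h : n.degree ≤ k then v ⟨n, h⟩ else 0, funext fun n => ?_⟩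
  change (if h : n.1.degree ≤ k then v ⟨n.1, h⟩ else 0) = _
  rw [dif_pos n.2]

theorem sub_sum_monomial_mem {d : ℕ} (k : ℕ) (f : MvPowerSeries (Fin d) ℂ) :
    f - ∑ n : Exponents d k, coeff n.1 f • monomial n.1 (1 : ℂ) ∈ maxIdeal d ^ (k + 1) := by
  classical
  rw [← jet_eq_zero]
  ext n
  rw [jet_apply, map_sub, map_sum, Finset.sum_eq_single n]
  · simp
  · intro m _ hm
    rw [map_smul, coeff_monomial_ne fun h => hm (Subtype.ext h.symm), smul_zero]
  · simp

theorem monomial_mem_maxIdeal_pow {d : ℕ} (n : Fin d →₀ ℕ) (a : ℂ) :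
    monomial n a ∈ maxIdeal d ^ n.degree := by
  rw [mem_maxIdeal_pow]
  intro m hm
  exact coeff_monomial_ne (by rintro rfl; exact lt_irrefl _ hm) a

theorem FormalSelfMap.pullback_mem_maxIdeal_pow {d j : ℕ} (F : FormalSelfMap d)
    {f : MvPowerSeries (Fin d) ℂ} (hf : f ∈ maxIdeal d ^ j) :
    F.pullback f ∈ maxIdeal d ^ j := by
  have h : (maxIdeal d).map F.pullback ≤ maxIdeal d := by
    rw [Ideal.map_le_iff_le_comap]
    intro f hf
    change constantCoeff _ = 0
    rw [F.pullback_apply]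
    exact constantCoeff_subst_eq_zero F.hasSubst F.constantCoeff_comp hf
  have := Ideal.mem_map_of_mem F.pullback hf
  rw [Ideal.map_pow] at this
  exact Ideal.pow_right_mono h j this

/-- Pullback preserves $\mathfrak m^{|n|+1}$, so only the $|n|$-jet of $f$ matters. The sum being
finite, composition is matrix multiplication and derivatives in a parameter can be taken termwise.
-/
theorem FormalSelfMap.coeff_pullback {d : ℕ} (F : FormalSelfMap d) (n : Fin d →₀ ℕ)
    (f : MvPowerSeries (Fin d) ℂ) :
    coeff n (F.pullback f) =
      ∑ m : Exponents d n.degree, coeff m.1 f * coeff n (F.pullback (monomial m.1 1)) := by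
  have h := F.pullback_mem_maxIdeal_pow (sub_sum_monomial_mem n.degree f)
  have := mem_maxIdeal_pow.1 h n (Nat.lt_succ_self _)
  rw [map_sub, map_sub, sub_eq_zero] at this
  rw [this]
  simp [map_sum]

/-- The `k`-jets of the elements of an ideal. -/
noncomputable def jetImage {d : ℕ} (k : ℕ) (I : Ideal (MvPowerSeries (Fin d) ℂ)) :
    Submodule ℂ (Exponents d k → ℂ) :=
  (I.restrictScalars ℂ).map (jet d k)

theorem mem_jetImage {d k : ℕ} {I : Ideal (MvPowerSeries (Fin d) ℂ)} {v : Exponents d k → ℂ} :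
    v ∈ jetImage k I ↔ ∃ f ∈ I, jet d k f = v := by
  simp [jetImage]

theorem jet_mem_jetImage {d k : ℕ} {I : Ideal (MvPowerSeries (Fin d) ℂ)}
    {f : MvPowerSeries (Fin d) ℂ} :
    jet d k f ∈ jetImage k I ↔ f ∈ I ⊔ maxIdeal d ^ (k + 1) := by
  rw [mem_jetImage, Submodule.mem_sup]
  constructor
  · rintro ⟨g, hg, h⟩
    exact ⟨g, hg, f - g, jet_eq_zero.1 (by rw [map_sub, h, sub_self]), by ring⟩
  · rintro ⟨g, hg, h, hh, rfl⟩
    exact ⟨g, hg, by rw [map_add, jet_eq_zero.2 hh, add_zero]⟩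

/-- An ideal containing $\mathfrak m^{k+1}$, the kernel of the jet map, is recovered from its
$k$-jets. -/
theorem jetImage_lt {d k : ℕ} {I J : Ideal (MvPowerSeries (Fin d) ℂ)} (hJ : J ≤ I)
    (hk : maxIdeal d ^ (k + 1) ≤ J) (hne : ¬ I ≤ J) : jetImage k J < jetImage k I := by
  refine lt_of_le_not_ge (Submodule.map_mono fun _ h => hJ h) fun h => hne fun f hf => ?_
  have := h (jet_mem_jetImage.2 (Ideal.mem_sup_left hf))
  rwa [jet_mem_jetImage, sup_eq_left.2 hk] at this

/-- Otherwise the chain $I+\mathfrak m^j$, $0\le j\le k+1$, drops strictly $k+1$ times, since by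
Nakayama an equality would give $\mathfrak m^j\le I$. All its terms contain $\mathfrak m^{k+1}$, so
the drops persist on $k$-jets and the jets of $I$ have codimension greater than $k$. -/
theorem pow_maxIdeal_le_of_card_le {d k : ℕ} {I : Ideal (MvPowerSeries (Fin d) ℂ)}
    (h : Fintype.card (Exponents d k) ≤ Module.finrank ℂ (jetImage k I) + k) :
    maxIdeal d ^ (k + 1) ≤ I := by
  by_contra hI
  have key : ∀ j ≤ k + 1, Module.finrank ℂ (jetImage k (I ⊔ maxIdeal d ^ j)) + j ≤
      Fintype.card (Exponents d k) := by
    intro j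
    induction j with
    | zero =>
      intro _
      simpa using Submodule.finrank_le (jetImage k (I ⊔ maxIdeal d ^ 0))
    | succ j ih =>
      intro hj
      have hlt : jetImage k (I ⊔ maxIdeal d ^ (j + 1)) < jetImage k (I ⊔ maxIdeal d ^ j) := by
        refine jetImage_lt (sup_le_sup_left (Ideal.pow_le_pow_right j.le_succ) _)
          ((Ideal.pow_le_pow_right hj).trans le_sup_right) fun hle => hI ?_
        exact (Ideal.pow_le_pow_right (by omega)).trans
          (pow_maxIdeal_le_of_le_sup (le_sup_right.trans hle))
      have := Submodule.finrank_lt_finrank_of_lt hlt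
      have := ih (by omega)
      omega
  have h1 := key (k + 1) le_rfl
  have h2 : jetImage k I ≤ jetImage k (I ⊔ maxIdeal d ^ (k + 1)) :=
    Submodule.map_mono fun _ h => Ideal.mem_sup_left h
  have := Submodule.finrank_mono h2
  omega

/-- The same $k$ serves as codimension bound and as jet order: codimension at most $k$ on $k$-jets
already forces $\mathfrak m^{k+1}\le I$, so that nothing is lost by truncation. -/
theorem rank_quotient_le_iff {d k : ℕ} {I : Ideal (MvPowerSeries (Fin d) ℂ)} :
    Module.rank ℂ (MvPowerSeries (Fin d) ℂ ⧸ I) ≤ k ↔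
      Fintype.card (Exponents d k) ≤ Module.finrank ℂ (jetImage k I) + k := by
  have hfin := Submodule.finrank_quotient_add_finrank (jetImage k I)
  rw [Module.finrank_fintype_fun_eq_card] at hfin
  have hmap : I.restrictScalars ℂ ≤ (jetImage k I).comap (jet d k) := Submodule.le_comap_map _ _
  rw [← (Submodule.Quotient.restrictScalarsEquiv ℂ I).rank_eq]
  let φ := Submodule.mapQ (I.restrictScalars ℂ) (jetImage k I) (jet d k) hmap
  constructor
  · intro h
    have hφ : Function.Surjective φ := by
      intro y
      obtain ⟨v, rfl⟩ := Submodule.Quotient.mk_surjective _ y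
      obtain ⟨f, rfl⟩ := jet_surjective d k v
      exact ⟨Submodule.Quotient.mk f, rfl⟩
    have := (LinearMap.rank_le_of_surjective φ hφ).trans h
    rw [← Module.finrank_eq_rank] at this
    have : Module.finrank ℂ ((Exponents d k → ℂ) ⧸ jetImage k I) ≤ k := by exact_mod_cast this
    omega
  · intro h
    have hI := pow_maxIdeal_le_of_card_le h
    have hφ : Function.Injective φ := by
      rw [injective_iff_map_eq_zero]
      intro x hx
      obtain ⟨f, rfl⟩ := Submodule.Quotient.mk_surjective _ x
      have hx' : jet d k f ∈ jetImage k I := (Submodule.Quotient.mk_eq_zero _).1 hx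
      rw [jet_mem_jetImage, sup_eq_left.2 hI] at hx'
      exact (Submodule.Quotient.mk_eq_zero _).2 hx'
    refine (LinearMap.rank_le_of_injective φ hφ).trans ?_
    rw [← Module.finrank_eq_rank]
    have : Module.finrank ℂ ((Exponents d k → ℂ) ⧸ jetImage k I) ≤ k := by omega
    exact_mod_cast this

/-! ### Noetherian families of maps and the uniform bound -/

/-- A decreasing sequence of sets each of which is cut out by functions from a Noetherian
algebra of functions is stationary. -/
theorem exists_stationary_of_noetherian {Λ : Type*} (R : Subalgebra ℂ (Λ → ℂ))
    [IsNoetherianRing R] (Z : ℕ → Set Λ) (hZ : Antitone Z)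
    (hcut : ∀ k, ∀ a ∉ Z k, ∃ r ∈ R, (∀ b ∈ Z k, r b = 0) ∧ r a ≠ 0) :
    ∃ k₀, ∀ k ≥ k₀, Z k₀ ⊆ Z k := by
  -- The vanishing ideals of the sets `Z k` increase. Once they are constant, a function separating
  -- `a` from `Z k` also vanishes on `Z k₀`, so `a` is not there.
  let J : ℕ →o Ideal R :=
    { toFun := fun k =>
        { carrier := {r | ∀ b ∈ Z k, r.1 b = 0}
          add_mem' := fun {r s} hr hs b hb => by
            change r.1 b + s.1 b = 0
            rw [hr b hb, hs b hb, add_zero]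
          zero_mem' := fun b _ => rfl
          smul_mem' := fun c r hr b hb => by
            change c.1 b * r.1 b = 0
            rw [hr b hb, mul_zero] }
      monotone' := fun i j hij r hr b hb => hr b (hZ hij hb) }
  obtain ⟨k₀, hk₀⟩ := monotone_stabilizes_iff_noetherian.2 ‹IsNoetherianRing R› J
  refine ⟨k₀, fun k hk a ha => ?_⟩
  by_contra hak
  obtain ⟨r, hr, hrZ, hra⟩ := hcut k a hak
  have : (⟨r, hr⟩ : R) ∈ J k := hrZ
  rw [← hk₀ k hk] at this
  exact hra (this a ha)

/-- A family of formal maps is regular with respect to an algebra `R` of functions of the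
parameter if all coefficients of its composition operators belong to `R`. -/
def IsRegularFamily {Λ : Type*} {d : ℕ} (R : Subalgebra ℂ (Λ → ℂ)) (g : Λ → FormalDiff d) : Prop :=
  ∀ (n : Fin d →₀ ℕ) (f : MvPowerSeries (Fin d) ℂ),
    (fun a => coeff n ((g a).val.pullback f)) ∈ R

theorem IsRegularFamily.one {Λ : Type*} {d : ℕ} (R : Subalgebra ℂ (Λ → ℂ)) :
    IsRegularFamily R (fun _ => (1 : FormalDiff d)) := by
  intro n f
  simp only [Units.val_one, FormalSelfMap.pullback_one]
  exact R.algebraMap_mem (coeff n f)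

theorem IsRegularFamily.mul {Λ : Type*} {d : ℕ} {R : Subalgebra ℂ (Λ → ℂ)}
    {g h : Λ → FormalDiff d} (hg : IsRegularFamily R g) (hh : IsRegularFamily R h) :
    IsRegularFamily R (fun a => g a * h a) := by
  intro n f
  have : (fun a => coeff n ((g a * h a).val.pullback f)) = ∑ m : Exponents d n.degree,
      (fun a => coeff m.1 ((g a).val.pullback f)) *
        fun a => coeff n ((h a).val.pullback (monomial m.1 1)) := by
    funext a
    rw [Units.val_mul, FormalSelfMap.pullback_mul, FormalSelfMap.coeff_pullback, Finset.sum_apply]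
    rfl
  rw [this]
  exact R.sum_mem fun m _ => R.mul_mem (hg _ _) (hh _ _)

theorem mem_preimage_sup {d : ℕ} {X Y : FormalSubvariety d} {g : FormalDiff d}
    {f : MvPowerSeries (Fin d) ℂ} :
    f ∈ (X.preimage g).ideal ⊔ Y.ideal ↔
      ∃ a ∈ X.ideal, ∃ b ∈ Y.ideal, g.val.pullback a + b = f := by
  rw [Submodule.mem_sup]
  constructor
  · rintro ⟨y, hy, b, hb, rfl⟩
    obtain ⟨a, ha, rfl⟩ := (Ideal.mem_map_of_equiv g.pullbackEquiv y).1 hy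
    exact ⟨a, ha, b, hb, rfl⟩
  · rintro ⟨a, ha, b, hb, rfl⟩
    exact ⟨_, (Ideal.mem_map_of_equiv g.pullbackEquiv _).2 ⟨a, ha, rfl⟩, b, hb, rfl⟩

theorem intersectionMultiplicity_le_iff {d k : ℕ} {X Y : FormalSubvariety d} :
    intersectionMultiplicity X Y ≤ k ↔ Fintype.card (Exponents d k) ≤
      Module.finrank ℂ (jetImage k (X.ideal ⊔ Y.ideal)) + k := by
  rw [intersectionMultiplicity, Cardinal.toENat_le_natCast, rank_quotient_le_iff]

/-- The condition `μ(g⁻¹(X), Y) ≤ k` is open: at each parameter where it holds some function from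
the algebra does not vanish, and it holds wherever this function does not vanish. -/
theorem IsRegularFamily.exists_mem_of_multiplicity_le {Λ : Type*} {d k : ℕ}
    {R : Subalgebra ℂ (Λ → ℂ)} {g : Λ → FormalDiff d} (hg : IsRegularFamily R g)
    (X Y : FormalSubvariety d) {a : Λ}
    (ha : intersectionMultiplicity (X.preimage (g a)) Y ≤ k) :
    ∃ r ∈ R, r a ≠ 0 ∧
      ∀ b, r b ≠ 0 → intersectionMultiplicity (X.preimage (g b)) Y ≤ k := by
  classical
  rw [intersectionMultiplicity_le_iff] at ha
  set W := jetImage k ((X.preimage (g a)).ideal ⊔ Y.ideal) with hW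
  let v := Module.finBasis ℂ W
  have hv : ∀ i, ∃ u w, u ∈ X.ideal ∧ w ∈ Y.ideal ∧
      jet d k ((g a).val.pullback u + w) = (v i : Exponents d k → ℂ) := by
    intro i
    obtain ⟨f, hf, hfv⟩ := mem_jetImage.1 (v i).2
    obtain ⟨u, hu, w, hw, rfl⟩ := mem_preimage_sup.1 hf
    exact ⟨u, w, hu, hw, hfv⟩
  choose u w hu hw huw using hv
  let s : Λ → Fin (Module.finrank ℂ W) → Exponents d k → ℂ :=
    fun b i => jet d k ((g b).val.pullback (u i) + w i)
  have hs : LinearIndependent ℂ (s a) := by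
    have : s a = W.subtype ∘ v := funext huw
    rw [this]
    exact v.linearIndependent.map' _ (Submodule.ker_subtype _)
  -- Coordinates adapted to the parameter `a`: a single determinant, equal to 1 at `a`, then tests
  -- the independence of the vectors `s b`.
  obtain ⟨P, hP⟩ := LinearMap.exists_leftInverse_of_injective
    (Fintype.linearCombination ℂ (s a)) (LinearMap.ker_eq_bot.2
      (linearIndependent_iff_injective_fintypeLinearCombination.1 hs))
  let D : Λ → Matrix (Fin (Module.finrank ℂ W)) (Fin (Module.finrank ℂ W)) ℂ :=
    fun b => Matrix.of fun i j => P (s b i) j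
  have hentry : ∀ i j, (fun b => D b i j) ∈ R := by
    intro i j
    have : (fun b => D b i j) = ∑ n : Exponents d k,
        P (Pi.single n 1) j • (fun b => coeff n.1 ((g b).val.pullback (u i)) + coeff n.1 (w i)) := by
      funext b
      change P (s b i) j = _
      conv_lhs => rw [pi_eq_sum_univ' (s b i)]
      simp only [map_sum, map_smul, Finset.sum_apply, Pi.smul_apply, smul_eq_mul]
      refine Finset.sum_congr rfl fun n _ => ?_
      rw [mul_comm, ← map_add]
      congr 3
    rw [this]
    exact R.sum_mem fun n _ => R.smul_mem
      (R.add_mem (hg _ _) (R.algebraMap_mem (coeff n.1 (w i)))) _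
  refine ⟨fun b => (D b).det, ?_, ?_, fun b hb => ?_⟩
  · have : (fun b => (D b).det) = ∑ σ : Equiv.Perm (Fin (Module.finrank ℂ W)),
        ((Equiv.Perm.sign σ : ℤ) : ℂ) • ∏ i, fun b => D b (σ i) i := by
      funext b
      simp [Matrix.det_apply', Finset.sum_apply, Finset.prod_apply]
    rw [this]
    exact R.sum_mem fun σ _ => R.smul_mem (R.prod_mem fun i _ => hentry _ _) _
  · have : D a = 1 := by
      ext i j
      have := congrFun (LinearMap.congr_fun hP (Pi.single i 1)) j
      rw [LinearMap.comp_apply, Fintype.linearCombination_apply_single, one_smul] at this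
      change P (s a i) j = _
      rw [this, LinearMap.id_apply, Matrix.one_apply, Pi.single_apply]
      simp only [eq_comm]
    simp [this]
  · rw [intersectionMultiplicity_le_iff]
    refine ha.trans (Nat.add_le_add_right ?_ k)
    have hrows : LinearIndependent ℂ (fun i => P (s b i)) :=
      Matrix.linearIndependent_rows_of_isUnit
        ((Matrix.isUnit_iff_isUnit_det _).2 (isUnit_iff_ne_zero.2 hb))
    have hsb : LinearIndependent ℂ (s b) := LinearIndependent.of_comp P hrows
    let t : Fin (Module.finrank ℂ W) → jetImage k ((X.preimage (g b)).ideal ⊔ Y.ideal) :=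
      fun i => ⟨s b i, mem_jetImage.2 ⟨_, mem_preimage_sup.2 ⟨u i, hu i, w i, hw i, rfl⟩, rfl⟩⟩
    have ht : LinearIndependent ℂ t := LinearIndependent.of_comp (Submodule.subtype _) hsb
    simpa using ht.fintype_card_le_finrank

theorem IsRegularFamily.exists_multiplicity_bound {Λ : Type*} {d : ℕ}
    {R : Subalgebra ℂ (Λ → ℂ)} (hR : R.FG) {g : Λ → FormalDiff d} (hg : IsRegularFamily R g)
    (X Y : FormalSubvariety d) :
    ∃ m : ℕ, ∀ a, intersectionMultiplicity (X.preimage (g a)) Y < ⊤ →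
      intersectionMultiplicity (X.preimage (g a)) Y ≤ m := by
  have : IsNoetherianRing R := isNoetherianRing_of_fg hR
  obtain ⟨m, hm⟩ := exists_stationary_of_noetherian R
    (fun k => {a | ¬ intersectionMultiplicity (X.preimage (g a)) Y ≤ k})
    (fun i j hij a ha h => ha (h.trans (by exact_mod_cast hij)))
    (fun k a ha => by
      obtain ⟨r, hr, hra, hrb⟩ := hg.exists_mem_of_multiplicity_le X Y (not_not.1 ha)
      exact ⟨r, hr, fun b hb => not_not.1 fun h => hb (hrb b h), hra⟩)
  refine ⟨m, fun a ha => ?_⟩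
  obtain ⟨n, hn⟩ := ENat.ne_top_iff_exists.1 ha.ne
  by_contra h
  -- The finite value `n` at `a` would have to exceed every `k ≥ m`; `k = max m n` is a
  -- contradiction.
  exact hm (max m n) (le_max_left _ _) h (hn.symm.le.trans (by exact_mod_cast le_max_right m n))

/-! ### Generalized eigenvectors modulo a subspace -/

/-- A vector is annihilated modulo the subspace `N` by a product of operators `T - s`, `s ∈ M`. -/
inductive KilledMod {V : Type*} [AddCommGroup V] [Module ℂ V] (T : V →ₗ[ℂ] V) (M : Set ℂ)
    (N : Submodule ℂ V) : V → Prop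
  | of_mem {f : V} (hf : f ∈ N) : KilledMod T M N f
  | of_sub {f : V} {s : ℂ} (hs : s ∈ M) (h : KilledMod T M N (T f - s • f)) : KilledMod T M N f

namespace KilledMod

variable {V : Type*} [AddCommGroup V] [Module ℂ V] {T : V →ₗ[ℂ] V} {M : Set ℂ}
  {N : Submodule ℂ V}

theorem trans {N' : Submodule ℂ V} {f : V} (hf : KilledMod T M N f)
    (h : ∀ g ∈ N, KilledMod T M N' g) : KilledMod T M N' f := by
  induction hf with
  | of_mem hf => exact h _ hf
  | of_sub hs _ ih => exact of_sub hs ih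

theorem mono_left {M' : Set ℂ} (hM : M ⊆ M') {f : V} (hf : KilledMod T M N f) :
    KilledMod T M' N f := by
  induction hf with
  | of_mem hf => exact of_mem hf
  | of_sub hs _ ih => exact of_sub (hM hs) ih

theorem mono_right {N' : Submodule ℂ V} (hN : N ≤ N') {f : V} (hf : KilledMod T M N f) :
    KilledMod T M N' f :=
  hf.trans fun _ hg => of_mem (hN hg)

theorem map (U : V →ₗ[ℂ] V) (hU : ∀ f ∈ N, U f ∈ N) (hTU : ∀ f, T (U f) = U (T f)) {f : V}
    (hf : KilledMod T M N f) : KilledMod T M N (U f) := by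
  induction hf with
  | of_mem hf => exact of_mem (hU _ hf)
  | of_sub hs _ ih =>
    refine of_sub hs ?_
    rwa [hTU, ← map_smul, ← map_sub]

theorem smul (c : ℂ) {f : V} (hf : KilledMod T M N f) : KilledMod T M N (c • f) :=
  hf.map (c • LinearMap.id) (fun f hf => N.smul_mem c hf) fun f => by simp

/-- The operators $T-s$ commute, so the product of the two annihilating products kills the sum. -/
theorem add (hT : ∀ f ∈ N, T f ∈ N) {f g : V} (hf : KilledMod T M N f)
    (hg : KilledMod T M N g) : KilledMod T M N (f + g) := by
  induction hf generalizing g with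
  | @of_mem f hf =>
    induction hg generalizing f with
    | of_mem hg => exact of_mem (N.add_mem hf hg)
    | @of_sub g s hs _ ih =>
      refine of_sub hs ?_
      have : T (f + g) - s • (f + g) = (T f - s • f) + (T g - s • g) := by
        rw [map_add, smul_add]; abel
      rw [this]
      exact ih (N.sub_mem (hT f hf) (N.smul_mem s hf))
  | @of_sub f s hs _ ih =>
    refine of_sub hs ?_
    have : T (f + g) - s • (f + g) = (T f - s • f) + (T g - s • g) := by
      rw [map_add, smul_add]; abel
    rw [this]
    refine ih (hg.map (T - s • LinearMap.id) (fun f hf => ?_) fun f => ?_)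
    · exact N.sub_mem (hT f hf) (N.smul_mem s hf)
    · simp

theorem sum (hT : ∀ f ∈ N, T f ∈ N) {ι : Type*} (s : Finset ι) (f : ι → V)
    (hf : ∀ i ∈ s, KilledMod T M N (f i)) : KilledMod T M N (∑ i ∈ s, f i) :=
  Finset.sum_induction f (KilledMod T M N) (fun _ _ => add hT) (of_mem N.zero_mem) hf

/-- Used with `E` a space of quasipolynomials: `hM` says that `E` contains the solutions of the
first-order equations to which `Φ` converts $T-s$. -/
theorem map_mem {W : Type*} [AddCommGroup W] [Module ℂ W] (Φ : V →ₗ[ℂ] W) (E : Submodule ℂ W)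
    (hN : ∀ f ∈ N, Φ f ∈ E) (hM : ∀ s ∈ M, ∀ f, Φ (T f - s • f) ∈ E → Φ f ∈ E) {f : V}
    (hf : KilledMod T M N f) : Φ f ∈ E := by
  induction hf with
  | of_mem hf => exact hN _ hf
  | of_sub hs _ ih => exact hM _ hs _ ih

end KilledMod

/-- On a finite-dimensional quotient every vector is annihilated by a product of operators
`T - s` with `s` an eigenvalue. -/
theorem exists_finite_killedMod {V : Type*} [AddCommGroup V] [Module ℂ V] (T : V →ₗ[ℂ] V)
    (N : Submodule ℂ V) [Module.Finite ℂ (V ⧸ N)] (hT : ∀ f ∈ N, T f ∈ N) :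
    ∃ M : Set ℂ, M.Finite ∧ (∀ f, KilledMod T M N f) ∧ (Function.Surjective T → 0 ∉ M) := by
  let T' : Module.End ℂ (V ⧸ N) := N.mapQ N T hT
  refine ⟨{s | s ∈ (minpoly ℂ T').roots}, Multiset.finite_toSet _, fun f => ?_, fun hsurj h0 => ?_⟩
  · have key : ∀ (r : Multiset ℂ) (f : V), (∀ s ∈ r, s ∈ (minpoly ℂ T').roots) →
        Polynomial.aeval T' (r.map fun s => Polynomial.X - Polynomial.C s).prod
          (Submodule.Quotient.mk f) = 0 →
        KilledMod T {s | s ∈ (minpoly ℂ T').roots} N f := by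
      intro r
      induction r using Multiset.induction_on with
      | empty =>
        intro f _ h
        rw [Multiset.map_zero, Multiset.prod_zero, map_one] at h
        exact .of_mem ((Submodule.Quotient.mk_eq_zero N).1 h)
      | cons s r ih =>
        intro f hr h
        refine .of_sub (hr s (Multiset.mem_cons_self s r))
          (ih _ (fun t ht => hr t (Multiset.mem_cons_of_mem ht)) ?_)
        rw [Multiset.map_cons, Multiset.prod_cons, mul_comm, map_mul] at h
        rw [← h, Module.End.mul_apply]
        congr 1
        simp only [map_sub, Polynomial.aeval_X, Polynomial.aeval_C, LinearMap.sub_apply,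
          Module.algebraMap_end_apply, Submodule.Quotient.mk_sub, Submodule.Quotient.mk_smul]
        rfl
    refine key _ f (fun _ h => h) ?_
    rw [← (IsAlgClosed.splits _).eq_prod_roots_of_monic
      (minpoly.monic (Algebra.IsIntegral.isIntegral T')), minpoly.aeval]
    rfl
  · have hroot : (minpoly ℂ T').IsRoot 0 := (Polynomial.mem_roots'.1 h0).2
    obtain ⟨v, hv⟩ := (Module.End.hasEigenvalue_of_isRoot hroot).exists_hasEigenvector
    have hs' : Function.Surjective T' := by
      intro y
      obtain ⟨f, rfl⟩ := Submodule.Quotient.mk_surjective N y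
      obtain ⟨g, rfl⟩ := hsurj f
      exact ⟨Submodule.Quotient.mk g, rfl⟩
    have hinj := (LinearMap.injective_iff_surjective (f := T')).2 hs'
    refine hv.2 (hinj ?_)
    rw [map_zero, hv.apply_eq_smul, zero_smul]

/-- The filtration of `ℂ[[x₁, …, x_d]]` by the powers of the maximal ideal, as vector spaces. -/
noncomputable abbrev orderFiltration (d j : ℕ) : Submodule ℂ (MvPowerSeries (Fin d) ℂ) :=
  (maxIdeal d ^ j).restrictScalars ℂ

instance (d k : ℕ) : Module.Finite ℂ (MvPowerSeries (Fin d) ℂ ⧸ orderFiltration d (k + 1)) := by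
  have h : orderFiltration d (k + 1) = LinearMap.ker (jet d k) := by
    ext f
    exact jet_eq_zero.symm
  rw [h]
  exact Module.Finite.equiv ((jet d k).quotKerEquivOfSurjective (jet_surjective d k)).symm

/-- Operators on `ℂ[[x₁, …, x_d]]` for which the generalized eigenvectors form a subalgebra:
both automorphisms and derivations are of this kind. -/
structure IsTwistedLeibniz {d : ℕ} (T U : MvPowerSeries (Fin d) ℂ →ₗ[ℂ] MvPowerSeries (Fin d) ℂ)
    (op : ℂ → ℂ → ℂ) (c : ℂ → ℂ) : Prop where
  map_mem : ∀ j, ∀ f ∈ maxIdeal d ^ j, T f ∈ maxIdeal d ^ j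
  map_mem' : ∀ j, ∀ f ∈ maxIdeal d ^ j, U f ∈ maxIdeal d ^ j
  comm : ∀ f, T (U f) = U (T f)
  leibniz : ∀ s t u v, T (u * v) - op s t • (u * v) =
    (T u - s • u) * U v + u * (c s • (T v - t • v))

namespace IsTwistedLeibniz

variable {d : ℕ} {T U : MvPowerSeries (Fin d) ℂ →ₗ[ℂ] MvPowerSeries (Fin d) ℂ}
  {op : ℂ → ℂ → ℂ} {c : ℂ → ℂ} {M : Set ℂ}

/-- By `leibniz`, applying $T-\mathrm{op}(s,t)$ to $uv$ gives one term in which the annihilator of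
$u$ is shorter and one in which that of $v$ is shorter. When either is exhausted, the extra order of
that factor puts the product in $\mathfrak m^{j+2}$. -/
theorem killedMod_mul (h : IsTwistedLeibniz T U op c) (hM : ∀ s ∈ M, ∀ t ∈ M, op s t ∈ M) {j : ℕ}
    {u v : MvPowerSeries (Fin d) ℂ} (hu : u ∈ maxIdeal d) (hv : v ∈ maxIdeal d ^ j)
    (hu' : KilledMod T M (orderFiltration d 2) u)
    (hv' : KilledMod T M (orderFiltration d (j + 1)) v) :
    KilledMod T M (orderFiltration d (j + 2)) (u * v) := by
  have hT1 : ∀ s, ∀ f ∈ maxIdeal d, T f - s • f ∈ maxIdeal d := fun s f hf => by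
    have := h.map_mem 1
    rw [pow_one] at this
    exact Ideal.sub_mem _ (this f hf) (((maxIdeal d).restrictScalars ℂ).smul_mem s hf)
  have hTj : ∀ j s, ∀ f ∈ maxIdeal d ^ j, T f - s • f ∈ maxIdeal d ^ j := fun j s f hf =>
    Ideal.sub_mem _ (h.map_mem j f hf) ((orderFiltration d j).smul_mem s hf)
  induction hu' generalizing v with
  | of_mem hu2 =>
    refine .of_mem ?_
    rw [Submodule.restrictScalars_mem, add_comm, pow_add]
    exact Ideal.mul_mem_mul hu2 hv
  | @of_sub u s hs _ ihu =>
    induction hv' with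
    | of_mem hv2 =>
      refine .of_mem ?_
      rw [Submodule.restrictScalars_mem, show j + 2 = 1 + (j + 1) by ring, pow_add, pow_one]
      exact Ideal.mul_mem_mul hu hv2
    | @of_sub v t ht hv3 ihv =>
      refine .of_sub (hM s hs t ht) ?_
      rw [h.leibniz, mul_smul_comm]
      refine .add (h.map_mem _) (ihu (hT1 s u hu) (h.map_mem' j v hv) ?_)
        (.smul _ (ihv (hTj j t v hv)))
      exact (KilledMod.of_sub ht hv3).map U (h.map_mem' _) h.comm

theorem killedMod_monomial (h : IsTwistedLeibniz T U op c)
    (hM : ∀ s ∈ M, ∀ t ∈ M, op s t ∈ M) (h2 : ∀ f, KilledMod T M (orderFiltration d 2) f) (j : ℕ) :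
    ∀ n : Fin d →₀ ℕ, n.degree = j →
      KilledMod T M (orderFiltration d (j + 1)) (monomial n (1 : ℂ)) := by
  induction j with
  | zero =>
    refine fun n _ => (h2 _).mono_right fun f hf => ?_
    exact Ideal.pow_le_pow_right (show 0 + 1 ≤ 2 by omega) hf
  | succ j ih =>
    intro n hn
    obtain ⟨i, hi⟩ : ∃ i, n i ≠ 0 := by
      by_contra! h0
      have : n = 0 := Finsupp.ext h0
      simp [this] at hn
    have hle : Finsupp.single i 1 ≤ n := by rw [Finsupp.single_le_iff]; omega
    have hsplit : n = Finsupp.single i 1 + (n - Finsupp.single i 1) :=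
      (add_tsub_cancel_of_le hle).symm
    have hdeg : (n - Finsupp.single i 1).degree = j := by
      have := congrArg Finsupp.degree hsplit
      rw [map_add, Finsupp.degree_single] at this
      omega
    have hmon : monomial n (1 : ℂ) = X i * monomial (n - Finsupp.single i 1) 1 := by
      rw [X_def, monomial_mul_monomial, one_mul, ← hsplit]
    rw [hmon]
    exact h.killedMod_mul hM (constantCoeff_X i) (hdeg ▸ monomial_mem_maxIdeal_pow _ _) (h2 _)
      (ih _ hdeg)

/-- The eigenvalues modulo $\mathfrak m^2$ control all higher jets: on $\mathfrak m^k/\mathfrak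
m^{k+1}$ everything is spanned by products of variables. -/
theorem killedMod (h : IsTwistedLeibniz T U op c) (hM : ∀ s ∈ M, ∀ t ∈ M, op s t ∈ M)
    (h2 : ∀ f, KilledMod T M (orderFiltration d 2) f) (k : ℕ) (f : MvPowerSeries (Fin d) ℂ) :
    KilledMod T M (orderFiltration d k) f := by
  induction k with
  | zero => exact .of_mem (by simp)
  | succ k ih =>
    refine ih.trans fun g hg => ?_
    rw [← sub_add_cancel g (∑ n : Exponents d k, coeff n.1 g • monomial n.1 (1 : ℂ))]
    refine .add (h.map_mem _) (.of_mem (sub_sum_monomial_mem k g))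
      (.sum (h.map_mem _) _ _ fun n _ => ?_)
    rcases n.2.lt_or_eq with hlt | heq
    · rw [mem_maxIdeal_pow.1 hg n.1 hlt, zero_smul]
      exact .of_mem (Submodule.zero_mem _)
    · exact .smul _ (h.killedMod_monomial hM h2 k n.1 heq)

end IsTwistedLeibniz

/-! ### Quasipolynomial sequences and first-order recurrences -/

/-- The exponential sequence `k ↦ u ^ k`. -/
noncomputable def geomSeq (u : ℂˣ) : ℤ → ℂ := fun k => ((u ^ k : ℂˣ) : ℂ)

theorem geomSeq_mul (u v : ℂˣ) : geomSeq (u * v) = geomSeq u * geomSeq v := by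
  funext k
  simp [geomSeq, mul_zpow]

theorem geomSeq_one : geomSeq 1 = 1 := by
  funext k
  simp [geomSeq]

/-- The algebra generated by the identity sequence and by the exponential sequences with bases in
`S` and their inverses. -/
noncomputable def quasiPolynomialSeq (S : Set ℂˣ) : Subalgebra ℂ (ℤ → ℂ) :=
  Algebra.adjoin ℂ ({fun k : ℤ => (k : ℂ)} ∪ (geomSeq '' S ∪ geomSeq '' S⁻¹))

theorem quasiPolynomialSeq_fg {S : Set ℂˣ} (hS : S.Finite) : (quasiPolynomialSeq S).FG :=
  Subalgebra.fg_def.2 ⟨_, (Set.finite_singleton _).union ((hS.image _).union (hS.inv.image _)), rfl⟩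

theorem coe_mem_quasiPolynomialSeq (S : Set ℂˣ) :
    (fun k : ℤ => (k : ℂ)) ∈ quasiPolynomialSeq S :=
  Algebra.subset_adjoin (Or.inl rfl)

theorem geomSeq_mem {S : Set ℂˣ} {u : ℂˣ} (hu : u ∈ Subgroup.closure S) :
    geomSeq u ∈ quasiPolynomialSeq S := by
  suffices h : geomSeq u ∈ quasiPolynomialSeq S ∧ geomSeq u⁻¹ ∈ quasiPolynomialSeq S from h.1
  induction hu using Subgroup.closure_induction with
  | mem u hu =>
    exact ⟨Algebra.subset_adjoin (Or.inr (Or.inl ⟨u, hu, rfl⟩)),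
      Algebra.subset_adjoin (Or.inr (Or.inr ⟨u⁻¹, by simpa using hu, rfl⟩))⟩
  | one =>
    rw [inv_one, geomSeq_one]
    exact ⟨Subalgebra.one_mem _, Subalgebra.one_mem _⟩
  | mul u v _ _ hu hv =>
    rw [mul_inv, geomSeq_mul, geomSeq_mul]
    exact ⟨Subalgebra.mul_mem _ hu.1 hv.1, Subalgebra.mul_mem _ hu.2 hv.2⟩
  | inv u _ hu => exact ⟨hu.2, by rw [inv_inv]; exact hu.1⟩

theorem quasiPolynomialSeq_le_span (S : Set ℂˣ) :
    Subalgebra.toSubmodule (quasiPolynomialSeq S) ≤ Submodule.span ℂ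
      {h | ∃ u ∈ Subgroup.closure S, ∃ j : ℕ, h = fun k : ℤ => geomSeq u k * (k : ℂ) ^ j} := by
  rw [quasiPolynomialSeq, Algebra.adjoin_eq_span]
  refine Submodule.span_mono fun h hh => ?_
  induction hh using Submonoid.closure_induction with
  | mem h hh =>
    rcases hh with rfl | ⟨u, hu, rfl⟩ | ⟨u, hu, rfl⟩
    · exact ⟨1, Subgroup.one_mem _, 1, by simp [geomSeq_one]⟩
    · exact ⟨u, Subgroup.subset_closure hu, 0, by simp⟩
    · refine ⟨u, ?_, 0, by simp⟩
      rw [← inv_inv u]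
      exact Subgroup.inv_mem _ (Subgroup.subset_closure hu)
  | one => exact ⟨1, Subgroup.one_mem _, 0, by funext k; simp [geomSeq_one]⟩
  | mul a b _ _ ha hb =>
    obtain ⟨u, hu, i, rfl⟩ := ha
    obtain ⟨v, hv, j, rfl⟩ := hb
    refine ⟨u * v, Subgroup.mul_mem _ hu hv, i + j, ?_⟩
    funext k
    simp only [Pi.mul_apply, geomSeq_mul]
    ring

/-- The difference operator on sequences. -/
def differenceOp : (ℤ → ℂ) →ₗ[ℂ] (ℤ → ℂ) where
  toFun b k := b (k + 1) - b k
  map_add' a b := by funext k; simp only [Pi.add_apply]; ring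
  map_smul' c a := by funext k; simp only [Pi.smul_apply, smul_eq_mul, RingHom.id_apply]; ring

theorem differenceOp_apply (b : ℤ → ℂ) (k : ℤ) : differenceOp b k = b (k + 1) - b k := rfl

theorem geomSeq_mul_pow_mem {S : Set ℂˣ} {u : ℂˣ} (hu : u ∈ Subgroup.closure S) (j : ℕ) :
    (fun k : ℤ => geomSeq u k * (k : ℂ) ^ j) ∈ quasiPolynomialSeq S :=
  (quasiPolynomialSeq S).mul_mem (geomSeq_mem hu)
    ((quasiPolynomialSeq S).pow_mem (coe_mem_quasiPolynomialSeq S) j)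

/-- For $u\ne1$ the difference of $u^kk^j$ is $(u-1)u^kk^j$ plus terms of lower degree in $k$. In
the resonant case $u=1$ one starts from $k^{j+1}$, whose difference is $(j+1)k^j$ plus lower terms.
-/
theorem geomSeq_mul_pow_mem_map_differenceOp {S : Set ℂˣ} {u : ℂˣ}
    (hu : u ∈ Subgroup.closure S) (j : ℕ) :
    (fun k : ℤ => geomSeq u k * (k : ℂ) ^ j) ∈
      (Subalgebra.toSubmodule (quasiPolynomialSeq S)).map differenceOp := by
  induction j using Nat.strong_induction_on with
  | _ j ih =>
    set D := (Subalgebra.toSubmodule (quasiPolynomialSeq S)).map differenceOp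
    by_cases h1 : u = 1
    · subst h1
      have hb : differenceOp (fun k : ℤ => geomSeq 1 k * (k : ℂ) ^ (j + 1)) ∈ D :=
        Submodule.mem_map_of_mem (geomSeq_mul_pow_mem (Subgroup.one_mem _) (j + 1))
      have hsum : ∑ i ∈ Finset.range j, ((j + 1).choose i : ℂ) •
          (fun k : ℤ => geomSeq 1 k * (k : ℂ) ^ i) ∈ D :=
        D.sum_mem fun i hi => D.smul_mem _ (ih i (Finset.mem_range.1 hi))
      have hj : (j + 1 : ℂ) ≠ 0 := by exact_mod_cast Nat.succ_ne_zero j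
      convert D.smul_mem ((j + 1 : ℂ)⁻¹) (D.sub_mem hb hsum) using 1
      funext k
      simp only [Pi.smul_apply, Pi.sub_apply, differenceOp_apply, smul_eq_mul, geomSeq_one,
        Pi.one_apply, one_mul, Finset.sum_apply]
      push_cast
      rw [add_pow, Finset.sum_range_succ, Finset.sum_range_succ]
      simp only [one_pow, mul_one, Nat.choose_self, Nat.cast_one, Nat.choose_succ_self_right]
      rw [Finset.sum_congr rfl fun i _ => mul_comm ((k : ℂ) ^ i) _]
      field_simp
      push_cast
      ring
    · have hb : differenceOp (fun k : ℤ => geomSeq u k * (k : ℂ) ^ j) ∈ D :=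
        Submodule.mem_map_of_mem (geomSeq_mul_pow_mem hu j)
      have hsum : ∑ i ∈ Finset.range j, ((j.choose i : ℂ) * u) •
          (fun k : ℤ => geomSeq u k * (k : ℂ) ^ i) ∈ D :=
        D.sum_mem fun i hi => D.smul_mem _ (ih i (Finset.mem_range.1 hi))
      have hu1 : (u : ℂ) - 1 ≠ 0 := fun h => h1 (Units.ext (by simpa [sub_eq_zero] using h))
      convert D.smul_mem (((u : ℂ) - 1)⁻¹) (D.sub_mem hb hsum) using 1
      funext k
      have hk : geomSeq u (k + 1) = geomSeq u k * u := by simp [geomSeq, zpow_add_one]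
      simp only [Pi.smul_apply, Pi.sub_apply, differenceOp_apply, smul_eq_mul, Finset.sum_apply, hk]
      push_cast
      rw [add_pow, Finset.sum_range_succ]
      simp only [one_pow, mul_one, Nat.choose_self, Nat.cast_one]
      have : ∑ i ∈ Finset.range j, (j.choose i : ℂ) * u * (geomSeq u k * (k : ℂ) ^ i) =
          geomSeq u k * u * ∑ i ∈ Finset.range j, (k : ℂ) ^ i * (j.choose i : ℂ) := by
        rw [Finset.mul_sum]
        exact Finset.sum_congr rfl fun i _ => by ring
      rw [this]
      field_simp
      ring

/-- Variation of constants: the difference of $u^{-k}a(k)$ is a quasipolynomial, so it has a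
quasipolynomial primitive `b`, and $u^{-k}a(k)-b(k)$ is constant. -/
theorem mem_quasiPolynomialSeq_of_shift_sub {S : Set ℂˣ} {u : ℂˣ}
    (hu : u ∈ Subgroup.closure S) {a : ℤ → ℂ}
    (ha : (fun k => a (k + 1) - u * a k) ∈ quasiPolynomialSeq S) : a ∈ quasiPolynomialSeq S := by
  have hE : Subalgebra.toSubmodule (quasiPolynomialSeq S) ≤
      (Subalgebra.toSubmodule (quasiPolynomialSeq S)).map differenceOp := by
    refine (quasiPolynomialSeq_le_span S).trans (Submodule.span_le.2 ?_)
    rintro _ ⟨v, hv, j, rfl⟩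
    exact geomSeq_mul_pow_mem_map_differenceOp hv j
  obtain ⟨b, hb, hbeq⟩ := hE ((quasiPolynomialSeq S).smul_mem
    ((quasiPolynomialSeq S).mul_mem (geomSeq_mem (Subgroup.inv_mem _ hu)) ha) ((u⁻¹ : ℂˣ) : ℂ))
  have hstep : ∀ k, geomSeq u⁻¹ (k + 1) * a (k + 1) - b (k + 1) = geomSeq u⁻¹ k * a k - b k := by
    intro k
    have h := congrFun hbeq k
    rw [differenceOp_apply] at h
    simp only [Pi.smul_apply, Pi.mul_apply, smul_eq_mul] at h
    have hk : geomSeq u⁻¹ (k + 1) = geomSeq u⁻¹ k * (u⁻¹ : ℂˣ) := by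
      simp only [geomSeq, zpow_add_one, Units.val_mul]
    have huu : ((u⁻¹ : ℂˣ) : ℂ) * u = 1 := Units.inv_mul u
    rw [hk]
    linear_combination -h + geomSeq u⁻¹ k * a k * huu
  have hconst : ∀ k, geomSeq u⁻¹ k * a k - b k = geomSeq u⁻¹ 0 * a 0 - b 0 := by
    intro k
    induction k using Int.induction_on with
    | zero => rfl
    | succ i ih => rw [hstep, ih]
    | pred i ih => rw [← ih, ← hstep, sub_add_cancel]
  have : a = geomSeq u * (b + algebraMap ℂ (ℤ → ℂ) (geomSeq u⁻¹ 0 * a 0 - b 0)) := by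
    funext k
    have h := hconst k
    have huu : geomSeq u k * geomSeq u⁻¹ k = 1 := by
      rw [← Pi.mul_apply, ← geomSeq_mul, mul_inv_cancel, geomSeq_one, Pi.one_apply]
    rw [Pi.mul_apply, Pi.add_apply, Pi.algebraMap_apply, Algebra.algebraMap_self, RingHom.id_apply]
    linear_combination (-a k) * huu + geomSeq u k * h
  rw [this]
  exact (quasiPolynomialSeq S).mul_mem (geomSeq_mem hu)
    ((quasiPolynomialSeq S).add_mem hb ((quasiPolynomialSeq S).algebraMap_mem _))

/-! ### Quasipolynomial functions and first-order differential equations -/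

/-- The exponential function `t ↦ exp (s t)`. -/
noncomputable def expFun (s : ℂ) : ℂ → ℂ := fun t => Complex.exp (s * t)

theorem expFun_add (s t : ℂ) : expFun (s + t) = expFun s * expFun t := by
  funext x
  simp [expFun, add_mul, Complex.exp_add]

theorem expFun_zero : expFun 0 = 1 := by
  funext x
  simp [expFun]

theorem hasDerivAt_expFun (s t : ℂ) : HasDerivAt (expFun s) (s * expFun s t) t := by
  have h : HasDerivAt (expFun s) (Complex.exp (s * t) * (s * 1)) t :=
    ((hasDerivAt_id t).const_mul s).cexp
  rwa [mul_one, mul_comm] at h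

/-- The algebra generated by the identity function and by the exponential functions with exponents
in `S` and their inverses. -/
noncomputable def quasiPolynomialFun (S : Set ℂ) : Subalgebra ℂ (ℂ → ℂ) :=
  Algebra.adjoin ℂ ({fun t : ℂ => t} ∪ (expFun '' S ∪ expFun '' (-S)))

theorem quasiPolynomialFun_fg {S : Set ℂ} (hS : S.Finite) : (quasiPolynomialFun S).FG :=
  Subalgebra.fg_def.2 ⟨_, (Set.finite_singleton _).union ((hS.image _).union (hS.neg.image _)), rfl⟩

theorem id_mem_quasiPolynomialFun (S : Set ℂ) : (fun t : ℂ => t) ∈ quasiPolynomialFun S :=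
  Algebra.subset_adjoin (Or.inl rfl)

theorem expFun_mem {S : Set ℂ} {s : ℂ} (hs : s ∈ AddSubgroup.closure S) :
    expFun s ∈ quasiPolynomialFun S := by
  suffices h : expFun s ∈ quasiPolynomialFun S ∧ expFun (-s) ∈ quasiPolynomialFun S from h.1
  induction hs using AddSubgroup.closure_induction with
  | mem s hs =>
    exact ⟨Algebra.subset_adjoin (Or.inr (Or.inl ⟨s, hs, rfl⟩)),
      Algebra.subset_adjoin (Or.inr (Or.inr ⟨-s, by simpa using hs, rfl⟩))⟩
  | zero =>
    rw [neg_zero, expFun_zero]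
    exact ⟨Subalgebra.one_mem _, Subalgebra.one_mem _⟩
  | add s t _ _ hs ht =>
    rw [neg_add, expFun_add, expFun_add]
    exact ⟨Subalgebra.mul_mem _ hs.1 ht.1, Subalgebra.mul_mem _ hs.2 ht.2⟩
  | neg s _ hs => exact ⟨hs.2, by rw [neg_neg]; exact hs.1⟩

theorem quasiPolynomialFun_le_span (S : Set ℂ) :
    Subalgebra.toSubmodule (quasiPolynomialFun S) ≤ Submodule.span ℂ
      {h | ∃ s ∈ AddSubgroup.closure S, ∃ j : ℕ, h = fun t : ℂ => expFun s t * t ^ j} := by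
  rw [quasiPolynomialFun, Algebra.adjoin_eq_span]
  refine Submodule.span_mono fun h hh => ?_
  induction hh using Submonoid.closure_induction with
  | mem h hh =>
    rcases hh with rfl | ⟨s, hs, rfl⟩ | ⟨s, hs, rfl⟩
    · exact ⟨0, AddSubgroup.zero_mem _, 1, by simp [expFun_zero]⟩
    · exact ⟨s, AddSubgroup.subset_closure hs, 0, by simp⟩
    · refine ⟨s, ?_, 0, by simp⟩
      rw [← neg_neg s]
      exact AddSubgroup.neg_mem _ (AddSubgroup.subset_closure hs)
  | one => exact ⟨0, AddSubgroup.zero_mem _, 0, by funext t; simp [expFun_zero]⟩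
  | mul a b _ _ ha hb =>
    obtain ⟨s, hs, i, rfl⟩ := ha
    obtain ⟨t, ht, j, rfl⟩ := hb
    refine ⟨s + t, AddSubgroup.add_mem _ hs ht, i + j, ?_⟩
    funext x
    simp only [Pi.mul_apply, expFun_add]
    ring

/-- The derivatives of the elements of a space of functions. -/
def derivativeSpace (E : Submodule ℂ (ℂ → ℂ)) : Submodule ℂ (ℂ → ℂ) where
  carrier := {h | ∃ b ∈ E, ∀ t, HasDerivAt b (h t) t}
  add_mem' := by
    rintro _ _ ⟨b, hb, hb'⟩ ⟨c, hc, hc'⟩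
    exact ⟨b + c, E.add_mem hb hc, fun t => (hb' t).add (hc' t)⟩
  zero_mem' := ⟨0, E.zero_mem, fun t => hasDerivAt_const t 0⟩
  smul_mem' := by
    rintro z _ ⟨b, hb, hb'⟩
    exact ⟨z • b, E.smul_mem z hb, fun t => (hb' t).const_smul z⟩

theorem expFun_mul_pow_mem {S : Set ℂ} {s : ℂ} (hs : s ∈ AddSubgroup.closure S) (j : ℕ) :
    (fun t : ℂ => expFun s t * t ^ j) ∈ quasiPolynomialFun S :=
  (quasiPolynomialFun S).mul_mem (expFun_mem hs)
    ((quasiPolynomialFun S).pow_mem (id_mem_quasiPolynomialFun S) j)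

/-- Integration by parts lowers the power of $t$ when $s\ne0$; for $s=0$ the power is raised by one.
-/
theorem expFun_mul_pow_mem_derivativeSpace {S : Set ℂ} {s : ℂ}
    (hs : s ∈ AddSubgroup.closure S) (j : ℕ) :
    (fun t : ℂ => expFun s t * t ^ j) ∈
      derivativeSpace (Subalgebra.toSubmodule (quasiPolynomialFun S)) := by
  set D := derivativeSpace (Subalgebra.toSubmodule (quasiPolynomialFun S))
  by_cases h0 : s = 0
  · subst h0
    have hb : (fun t : ℂ => (j + 1 : ℂ) * t ^ j) ∈ D := by
      refine ⟨_, expFun_mul_pow_mem hs (j + 1), fun t => ?_⟩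
      simpa [expFun_zero] using hasDerivAt_pow (j + 1) t
    have hj : (j + 1 : ℂ) ≠ 0 := by exact_mod_cast Nat.succ_ne_zero j
    convert D.smul_mem ((j + 1 : ℂ)⁻¹) hb using 1
    funext t
    simp [expFun_zero, hj]
  · induction j with
    | zero =>
      have hb : (fun t : ℂ => s * expFun s t) ∈ D :=
        ⟨_, expFun_mem hs, fun t => hasDerivAt_expFun s t⟩
      convert D.smul_mem s⁻¹ hb using 1
      funext t
      simp [h0]
    | succ j ih =>
      have hb : (fun t : ℂ => s * expFun s t * t ^ (j + 1) + expFun s t * ((j + 1 : ℂ) * t ^ j)) ∈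
          D := by
        refine ⟨_, expFun_mul_pow_mem hs (j + 1), fun t => ?_⟩
        have h : HasDerivAt (fun t => expFun s t * t ^ (j + 1))
            (s * expFun s t * t ^ (j + 1) + expFun s t * (((j + 1 : ℕ) : ℂ) * t ^ j)) t :=
          (hasDerivAt_expFun s t).mul (hasDerivAt_pow (j + 1) t)
        rwa [Nat.cast_succ] at h
      convert D.smul_mem s⁻¹ (D.sub_mem hb (D.smul_mem (j + 1 : ℂ) ih)) using 1
      funext t
      simp only [Pi.smul_apply, Pi.sub_apply, smul_eq_mul]
      field_simp
      ring

/-- Variation of constants with integrating factor $e^{-st}$. -/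
theorem mem_quasiPolynomialFun_of_deriv_sub {S : Set ℂ} {s : ℂ}
    (hs : s ∈ AddSubgroup.closure S) {a a' : ℂ → ℂ} (hd : ∀ t, HasDerivAt a (a' t) t)
    (ha : (fun t => a' t - s * a t) ∈ quasiPolynomialFun S) : a ∈ quasiPolynomialFun S := by
  have hE : Subalgebra.toSubmodule (quasiPolynomialFun S) ≤
      derivativeSpace (Subalgebra.toSubmodule (quasiPolynomialFun S)) := by
    refine (quasiPolynomialFun_le_span S).trans (Submodule.span_le.2 ?_)
    rintro _ ⟨v, hv, j, rfl⟩
    exact expFun_mul_pow_mem_derivativeSpace hv j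
  obtain ⟨b, hb, hbd⟩ := hE ((quasiPolynomialFun S).mul_mem
    (expFun_mem (AddSubgroup.neg_mem _ hs)) ha)
  have hder : ∀ t, HasDerivAt (fun t => expFun (-s) t * a t - b t) 0 t := by
    intro t
    have h : HasDerivAt (fun t => expFun (-s) t * a t - b t)
        (-s * expFun (-s) t * a t + expFun (-s) t * a' t - expFun (-s) t * (a' t - s * a t)) t :=
      ((hasDerivAt_expFun (-s) t).mul (hd t)).sub (hbd t)
    rwa [show -s * expFun (-s) t * a t + expFun (-s) t * a' t -
      expFun (-s) t * (a' t - s * a t) = 0 by ring] at h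
  have hconst : ∀ t, expFun (-s) t * a t - b t = expFun (-s) 0 * a 0 - b 0 := fun t =>
    is_const_of_deriv_eq_zero (fun t => (hder t).differentiableAt) (fun t => (hder t).deriv) t 0
  have : a = expFun s * (b + algebraMap ℂ (ℂ → ℂ) (expFun (-s) 0 * a 0 - b 0)) := by
    funext t
    have h := hconst t
    have hss : expFun s t * expFun (-s) t = 1 := by
      rw [← Pi.mul_apply, ← expFun_add, add_neg_cancel, expFun_zero, Pi.one_apply]
    rw [Pi.mul_apply, Pi.add_apply, Pi.algebraMap_apply, Algebra.algebraMap_self, RingHom.id_apply]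
    linear_combination (-a t) * hss + expFun s t * h
  rw [this]
  exact (quasiPolynomialFun S).mul_mem (expFun_mem hs)
    ((quasiPolynomialFun S).add_mem hb ((quasiPolynomialFun S).algebraMap_mem _))

/-! ### Iterates of a formal map -/

theorem isTwistedLeibniz_pullback {d : ℕ} (F : FormalSelfMap d) :
    IsTwistedLeibniz F.pullback.toLinearMap F.pullback.toLinearMap (· * ·) id where
  map_mem _ _ hf := F.pullback_mem_maxIdeal_pow hf
  map_mem' _ _ hf := F.pullback_mem_maxIdeal_pow hf
  comm _ := rfl
  leibniz s t u v := by
    simp only [AlgHom.toLinearMap_apply, map_mul, smul_eq_C_mul, id]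
    ring

/-- The coefficients of the iterates of a formal map are quasipolynomials in the exponent. -/
theorem exists_fg_isRegularFamily_zpow {d : ℕ} (F : FormalDiff d) :
    ∃ R : Subalgebra ℂ (ℤ → ℂ), R.FG ∧ IsRegularFamily R (fun k : ℤ => F ^ k) := by
  have hT := isTwistedLeibniz_pullback F.val
  obtain ⟨M₀, hfin, hM₀, hzero⟩ := exists_finite_killedMod F.val.pullback.toLinearMap
    (orderFiltration d 2) (hT.map_mem 2)
  have h0 : (0 : ℂ) ∉ M₀ := hzero (FormalDiff.pullbackEquiv F).surjective
  -- The eigenvalues on $\mathbb C[[x]]/\mathfrak m^2$, nonzero because $F^*$ is surjective. They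
  -- are chosen before `n`, so one algebra serves all coefficients.
  let S : Set ℂˣ := {u | (u : ℂ) ∈ M₀}
  have hS : S.Finite := hfin.preimage Units.val_injective.injOn
  let M : Set ℂ := {s | ∃ u ∈ Subgroup.closure S, (u : ℂ) = s}
  have hM₀M : M₀ ⊆ M := fun s hs =>
    ⟨Units.mk0 s (by rintro rfl; exact h0 hs), Subgroup.subset_closure hs, rfl⟩
  have hM : ∀ s ∈ M, ∀ t ∈ M, s * t ∈ M := by
    rintro _ ⟨u, hu, rfl⟩ _ ⟨v, hv, rfl⟩
    exact ⟨u * v, Subgroup.mul_mem _ hu hv, rfl⟩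
  refine ⟨quasiPolynomialSeq S, quasiPolynomialSeq_fg hS, fun n f => ?_⟩
  let Φ : MvPowerSeries (Fin d) ℂ →ₗ[ℂ] (ℤ → ℂ) :=
    LinearMap.pi fun k => coeff n ∘ₗ (F ^ k).val.pullback.toLinearMap
  have hΦ : ∀ f k, Φ f k = coeff n ((F ^ k).val.pullback f) := fun _ _ => rfl
  refine KilledMod.map_mem Φ (Subalgebra.toSubmodule (quasiPolynomialSeq S))
    (fun f hf => ?_) ?_
    (hT.killedMod hM (fun f => (hM₀ f).mono_left hM₀M) (n.degree + 1) f)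
  · have : Φ f = 0 := funext fun k =>
      mem_maxIdeal_pow.1 ((F ^ k).val.pullback_mem_maxIdeal_pow hf) n (Nat.lt_succ_self _)
    rw [this]
    exact Submodule.zero_mem _
  -- Since $(F^{k+1})^*=(F^k)^*F^*$, the operator $F^*-u$ becomes the recurrence $a(k+1)-u\,a(k)$.
  · rintro _ ⟨u, hu, rfl⟩ f hf
    refine mem_quasiPolynomialSeq_of_shift_sub hu ?_
    rw [Subalgebra.mem_toSubmodule] at hf
    convert hf using 1
    funext k
    rw [map_sub, map_smul, Pi.sub_apply, Pi.smul_apply, smul_eq_mul, hΦ, hΦ, hΦ,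
      AlgHom.toLinearMap_apply, ← FormalSelfMap.pullback_mul, ← Units.val_mul, ← zpow_one_add,
      add_comm]

/-! ### Formal flows and the Lie derivative -/

section Flow

variable {d : ℕ} {v : FormalVectorField d} {φ : Multiplicative ℂ →* FormalDiff d}

/-- The series whose coefficients are the derivatives at `t = 0` of the coefficients of
`f ∘ e^{tv}`. -/
noncomputable def lieDerivativeFun (φ : Multiplicative ℂ →* FormalDiff d)
    (f : MvPowerSeries (Fin d) ℂ) : MvPowerSeries (Fin d) ℂ :=
  fun n => deriv (fun t : ℂ => coeff n ((φ (Multiplicative.ofAdd t)).val.pullback f)) 0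

theorem pullback_flow_zero (φ : Multiplicative ℂ →* FormalDiff d) (f : MvPowerSeries (Fin d) ℂ) :
    (φ (Multiplicative.ofAdd 0)).val.pullback f = f := by
  rw [ofAdd_zero, map_one, Units.val_one, FormalSelfMap.pullback_one]

theorem pullback_flow_add (φ : Multiplicative ℂ →* FormalDiff d) (s t : ℂ)
    (f : MvPowerSeries (Fin d) ℂ) :
    (φ (Multiplicative.ofAdd (s + t))).val.pullback f =
      (φ (Multiplicative.ofAdd t)).val.pullback ((φ (Multiplicative.ofAdd s)).val.pullback f) := by
  rw [ofAdd_add, map_mul, Units.val_mul, FormalSelfMap.pullback_mul]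

theorem hasDerivAt_coeff_mul {A B : ℂ → MvPowerSeries (Fin d) ℂ} {A' B' : MvPowerSeries (Fin d) ℂ}
    {t : ℂ} (hA : ∀ n, HasDerivAt (fun t => coeff n (A t)) (coeff n A') t)
    (hB : ∀ n, HasDerivAt (fun t => coeff n (B t)) (coeff n B') t) (n : Fin d →₀ ℕ) :
    HasDerivAt (fun t => coeff n (A t * B t)) (coeff n (A' * B t + A t * B')) t := by
  classical
  simp only [map_add, coeff_mul, ← Finset.sum_add_distrib]
  exact HasDerivAt.fun_sum fun p _ => (hA p.1).mul (hB p.2)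

/-- The definition of a flow differentiates only the components, that is, the pullbacks of the
variables; the product rule and induction on the degree give all monomials. -/
theorem differentiableAt_coeff_monomial (hφ : IsFormalFlow v φ) (m n : Fin d →₀ ℕ) :
    DifferentiableAt ℂ
      (fun t : ℂ => coeff n ((φ (Multiplicative.ofAdd t)).val.pullback (monomial m 1))) 0 := by
  suffices h : ∃ D : MvPowerSeries (Fin d) ℂ, ∀ n, HasDerivAt
      (fun t : ℂ => coeff n ((φ (Multiplicative.ofAdd t)).val.pullback (monomial m 1)))
      (coeff n D) 0 from (h.choose_spec n).differentiableAt
  clear n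
  obtain ⟨j, hj⟩ : ∃ j, m.degree = j := ⟨_, rfl⟩
  induction j generalizing m with
  | zero =>
    rw [Finsupp.degree_eq_zero_iff] at hj
    subst hj
    refine ⟨0, fun n => ?_⟩
    simp only [monomial_zero_one, map_one, coeff_zero]
    exact hasDerivAt_const _ _
  | succ j ih =>
    obtain ⟨i, hi⟩ : ∃ i, m i ≠ 0 := by
      by_contra! h0
      have : m = 0 := Finsupp.ext h0
      simp [this] at hj
    have hle : Finsupp.single i 1 ≤ m := by rw [Finsupp.single_le_iff]; omega
    have hsplit : m = Finsupp.single i 1 + (m - Finsupp.single i 1) :=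
      (add_tsub_cancel_of_le hle).symm
    have hdeg : (m - Finsupp.single i 1).degree = j := by
      have := congrArg Finsupp.degree hsplit
      rw [map_add, Finsupp.degree_single] at this
      omega
    have hmon : monomial m (1 : ℂ) = X i * monomial (m - Finsupp.single i 1) 1 := by
      rw [X_def, monomial_mul_monomial, one_mul, ← hsplit]
    obtain ⟨D, hD⟩ := ih _ hdeg
    refine ⟨v.comp i * (φ (Multiplicative.ofAdd 0)).val.pullback
      (monomial (m - Finsupp.single i 1) 1) +
        (φ (Multiplicative.ofAdd 0)).val.pullback (X i) * D, fun n => ?_⟩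
    simp only [hmon, map_mul]
    refine hasDerivAt_coeff_mul (fun n => ?_) hD n
    convert hφ i n using 4
    rw [FormalSelfMap.pullback_apply, subst_X (FormalSelfMap.hasSubst _)]

theorem hasDerivAt_coeff_flow_zero (hφ : IsFormalFlow v φ) (n : Fin d →₀ ℕ)
    (f : MvPowerSeries (Fin d) ℂ) :
    HasDerivAt (fun t : ℂ => coeff n ((φ (Multiplicative.ofAdd t)).val.pullback f))
      (coeff n (lieDerivativeFun φ f)) 0 := by
  refine DifferentiableAt.hasDerivAt ?_
  simp only [FormalSelfMap.coeff_pullback _ n f]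
  exact DifferentiableAt.fun_sum fun m _ =>
    (differentiableAt_coeff_monomial hφ m.1 n).const_mul _

theorem hasDerivAt_coeff_flow (hφ : IsFormalFlow v φ) (n : Fin d →₀ ℕ)
    (f : MvPowerSeries (Fin d) ℂ) (t : ℂ) :
    HasDerivAt (fun t : ℂ => coeff n ((φ (Multiplicative.ofAdd t)).val.pullback f))
      (coeff n ((φ (Multiplicative.ofAdd t)).val.pullback (lieDerivativeFun φ f))) t := by
  -- The group law moves the derivative from time 0 to time `t`; zero is written `t - t` to suit the
  -- translation of the argument.
  have h : HasDerivAt (fun s : ℂ => coeff n ((φ (Multiplicative.ofAdd (s + t))).val.pullback f))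
      (coeff n ((φ (Multiplicative.ofAdd t)).val.pullback (lieDerivativeFun φ f))) (t - t) := by
    simp only [pullback_flow_add, sub_self]
    rw [FormalSelfMap.coeff_pullback]
    simp only [FormalSelfMap.coeff_pullback _ n ((φ (Multiplicative.ofAdd _)).val.pullback f)]
    exact HasDerivAt.fun_sum fun m _ => (hasDerivAt_coeff_flow_zero hφ m.1 f).mul_const _
  simpa using h.comp_sub_const t t

/-- The Lie derivative `f ↦ d/dt (f ∘ e^{tv})` at `t = 0`. -/
noncomputable def lieDerivative (hφ : IsFormalFlow v φ) :
    MvPowerSeries (Fin d) ℂ →ₗ[ℂ] MvPowerSeries (Fin d) ℂ where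
  toFun := lieDerivativeFun φ
  map_add' f g := by
    ext n
    refine (hasDerivAt_coeff_flow_zero hφ n (f + g)).unique ?_
    simp only [map_add]
    exact (hasDerivAt_coeff_flow_zero hφ n f).add (hasDerivAt_coeff_flow_zero hφ n g)
  map_smul' c f := by
    ext n
    refine (hasDerivAt_coeff_flow_zero hφ n (c • f)).unique ?_
    simp only [map_smul, RingHom.id_apply]
    exact (hasDerivAt_coeff_flow_zero hφ n f).const_smul c

theorem lieDerivative_mul (hφ : IsFormalFlow v φ) (f g : MvPowerSeries (Fin d) ℂ) :
    lieDerivative hφ (f * g) = lieDerivative hφ f * g + f * lieDerivative hφ g := by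
  ext n
  refine (hasDerivAt_coeff_flow_zero hφ n (f * g)).unique ?_
  have h := hasDerivAt_coeff_mul (fun n => hasDerivAt_coeff_flow_zero hφ n f)
    (fun n => hasDerivAt_coeff_flow_zero hφ n g) n
  rw [pullback_flow_zero, pullback_flow_zero] at h
  simp only [map_mul]
  exact h

theorem isTwistedLeibniz_lieDerivative (hφ : IsFormalFlow v φ) :
    IsTwistedLeibniz (lieDerivative hφ) LinearMap.id (· + ·) (fun _ => 1) where
  map_mem j f hf := by
    rw [mem_maxIdeal_pow]
    intro n hn
    refine (hasDerivAt_coeff_flow_zero hφ n f).unique ?_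
    have : (fun t : ℂ => coeff n ((φ (Multiplicative.ofAdd t)).val.pullback f)) = fun _ => 0 :=
      funext fun t =>
        mem_maxIdeal_pow.1 (FormalSelfMap.pullback_mem_maxIdeal_pow _ hf) n hn
    rw [this]
    exact hasDerivAt_const _ _
  map_mem' _ _ hf := hf
  comm _ := rfl
  leibniz s t f g := by
    simp only [lieDerivative_mul, LinearMap.id_apply, smul_eq_C_mul, map_add, map_one]
    ring

/-- The coefficients of a formal flow are quasipolynomials in time. -/
theorem exists_fg_isRegularFamily_flow (hφ : IsFormalFlow v φ) :
    ∃ R : Subalgebra ℂ (ℂ → ℂ), R.FG ∧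
      IsRegularFamily R (fun t : ℂ => φ (Multiplicative.ofAdd t)) := by
  have hT := isTwistedLeibniz_lieDerivative hφ
  obtain ⟨S, hS, hS', -⟩ := exists_finite_killedMod (lieDerivative hφ)
    (orderFiltration d 2) (hT.map_mem 2)
  refine ⟨quasiPolynomialFun S, quasiPolynomialFun_fg hS, fun n f => ?_⟩
  let Φ : MvPowerSeries (Fin d) ℂ →ₗ[ℂ] (ℂ → ℂ) :=
    LinearMap.pi fun t => coeff n ∘ₗ (φ (Multiplicative.ofAdd t)).val.pullback.toLinearMap
  have hΦ : ∀ f t, Φ f t = coeff n ((φ (Multiplicative.ofAdd t)).val.pullback f) := fun _ _ => rfl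
  refine KilledMod.map_mem (M := (AddSubgroup.closure S : Set ℂ)) Φ
    (Subalgebra.toSubmodule (quasiPolynomialFun S)) (fun f hf => ?_) ?_
    (hT.killedMod (fun _ hs _ ht => AddSubgroup.add_mem _ hs ht)
      (fun f => (hS' f).mono_left AddSubgroup.subset_closure) (n.degree + 1) f)
  · have : Φ f = 0 := funext fun t =>
      mem_maxIdeal_pow.1 (FormalSelfMap.pullback_mem_maxIdeal_pow _ hf) n (Nat.lt_succ_self _)
    rw [this]
    exact Submodule.zero_mem _
  · intro s hs f hf
    refine mem_quasiPolynomialFun_of_deriv_sub hs (hasDerivAt_coeff_flow hφ n f) ?_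
    rw [Subalgebra.mem_toSubmodule] at hf
    convert hf using 1
    rw [map_sub, map_smul]
    rfl

end Flow

/-! ### Parametrization of the group and conclusion -/

open scoped IsMulCommutative

/-- The substitution of parameters as a homomorphism between algebras of functions. -/
noncomputable def substParam {Λ Λ' : Type*} (p : Λ' → Λ) : (Λ → ℂ) →ₐ[ℂ] (Λ' → ℂ) :=
  AlgHom.pi fun a => Pi.evalAlgHom ℂ (fun _ => ℂ) (p a)

theorem IsRegularFamily.comp {Λ Λ' : Type*} {d : ℕ} {R : Subalgebra ℂ (Λ → ℂ)}
    {g : Λ → FormalDiff d} (hg : IsRegularFamily R g) (p : Λ' → Λ) :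
    IsRegularFamily (R.map (substParam p)) (fun a => g (p a)) :=
  fun n f => ⟨_, hg n f, rfl⟩

theorem IsRegularFamily.mono {Λ : Type*} {d : ℕ} {R R' : Subalgebra ℂ (Λ → ℂ)}
    {g : Λ → FormalDiff d} (hg : IsRegularFamily R g) (h : R ≤ R') : IsRegularFamily R' g :=
  fun n f => h (hg n f)

theorem IsRegularFamily.prod {Λ ι : Type*} {d : ℕ} {R : Subalgebra ℂ (Λ → ℂ)}
    {G : Subgroup (FormalDiff d)} [IsMulCommutative G] (s : Finset ι) (g : ι → Λ → G)
    (hg : ∀ i ∈ s, IsRegularFamily R (fun a => (g i a : FormalDiff d))) :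
    IsRegularFamily R (fun a => ((∏ i ∈ s, g i a : G) : FormalDiff d)) := by
  classical
  induction s using Finset.induction_on with
  | empty => simpa using IsRegularFamily.one R
  | insert i s hi ih =>
    simp only [Finset.prod_insert hi, Subgroup.coe_mul]
    exact (hg i (Finset.mem_insert_self i s)).mul
      (ih fun j hj => hg j (Finset.mem_insert_of_mem hj))

theorem fg_iSup {A ι : Type*} [CommRing A] [Algebra ℂ A] [Finite ι] (R : ι → Subalgebra ℂ A)
    (hR : ∀ i, (R i).FG) : (⨆ i, R i).FG := by
  choose s hs hs' using fun i => Subalgebra.fg_def.1 (hR i)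
  refine Subalgebra.fg_def.2 ⟨⋃ i, s i, Set.finite_iUnion hs, ?_⟩
  rw [Algebra.adjoin_iUnion]
  simp only [hs']

/-- A commutative group generated by finitely many formal maps and flows is a regular family with
integer and complex parameters. -/
theorem exists_isRegularFamily_of_finitelyGenerated {d : ℕ} {G : Subgroup (FormalDiff d)}
    (hcomm : ∀ g ∈ G, ∀ h ∈ G, g * h = h * g) (hfg : IsFinitelyGeneratedByMapsAndFlows G) :
    ∃ (Λ : Type) (R : Subalgebra ℂ (Λ → ℂ)) (Ψ : Λ → FormalDiff d),
      R.FG ∧ IsRegularFamily R Ψ ∧ ∀ g ∈ G, ∃ a, Ψ a = g := by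
  obtain ⟨p, q, F, v, φ, hφ, hG⟩ := hfg
  have : IsMulCommutative G := ⟨⟨fun a b => Subtype.ext (hcomm a a.2 b b.2)⟩⟩
  have hF : ∀ i, F i ∈ G := fun i => by
    rw [hG]
    exact Subgroup.subset_closure (Or.inl ⟨i, rfl⟩)
  have hφG : ∀ k t, φ k t ∈ G := fun k t => by
    rw [hG]
    exact Subgroup.subset_closure (Or.inr (Set.mem_iUnion.2 ⟨k, t, rfl⟩))
  let F' : Fin p → G := fun i => ⟨F i, hF i⟩
  let φ' : Fin q → Multiplicative ℂ →* G := fun k => (φ k).codRestrict G (hφG k)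
  let Ψ : (Fin p → ℤ) × (Fin q → ℂ) → G := fun a =>
    (∏ i, F' i ^ a.1 i) * ∏ k, φ' k (Multiplicative.ofAdd (a.2 k))
  -- This is where commutativity enters: `Ψ` is a homomorphism, so its image is a subgroup and it
  -- suffices to reach the generators.
  have hadd : ∀ a b, Ψ (a + b) = Ψ a * Ψ b := fun a b => by
    simp only [Ψ, Prod.fst_add, Prod.snd_add, Pi.add_apply, zpow_add, ofAdd_add, map_mul,
      Finset.prod_mul_distrib]
    exact mul_mul_mul_comm _ _ _ _
  have hzero : Ψ 0 = 1 := by simp [Ψ]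
  choose R₁ hR₁ hR₁' using fun i => exists_fg_isRegularFamily_zpow (F i)
  choose R₂ hR₂ hR₂' using fun k => exists_fg_isRegularFamily_flow (hφ k)
  let S₁ : Fin p → Subalgebra ℂ ((Fin p → ℤ) × (Fin q → ℂ) → ℂ) := fun i =>
    (R₁ i).map (substParam fun a => a.1 i)
  let S₂ : Fin q → Subalgebra ℂ ((Fin p → ℤ) × (Fin q → ℂ) → ℂ) := fun k =>
    (R₂ k).map (substParam fun a => a.2 k)
  refine ⟨(Fin p → ℤ) × (Fin q → ℂ), (⨆ i, S₁ i) ⊔ ⨆ k, S₂ k, fun a => (Ψ a : FormalDiff d),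
    (fg_iSup S₁ fun i => (hR₁ i).map _).sup (fg_iSup S₂ fun k => (hR₂ k).map _), ?_, ?_⟩
  · have h₁ := IsRegularFamily.prod (R := (⨆ i, S₁ i) ⊔ ⨆ k, S₂ k) Finset.univ
      (fun i (a : (Fin p → ℤ) × (Fin q → ℂ)) => F' i ^ a.1 i) fun i _ =>
        ((hR₁' i).comp fun a : (Fin p → ℤ) × (Fin q → ℂ) => a.1 i).mono
          ((le_iSup S₁ i).trans le_sup_left)
    have h₂ := IsRegularFamily.prod (R := (⨆ i, S₁ i) ⊔ ⨆ k, S₂ k) Finset.univ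
      (fun k (a : (Fin p → ℤ) × (Fin q → ℂ)) => φ' k (Multiplicative.ofAdd (a.2 k))) fun k _ =>
        ((hR₂' k).comp fun a : (Fin p → ℤ) × (Fin q → ℂ) => a.2 k).mono
          ((le_iSup S₂ k).trans le_sup_right)
    exact h₁.mul h₂
  · intro g hg
    rw [hG] at hg
    induction hg using Subgroup.closure_induction with
    | mem g hg =>
      rcases hg with ⟨i, rfl⟩ | hg
      · refine ⟨(Pi.single i 1, 0), ?_⟩
        have : Ψ (Pi.single i 1, 0) = F' i := by
          simp only [Ψ, Pi.zero_apply, ofAdd_zero, map_one, Finset.prod_const_one, mul_one]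
          rw [Finset.prod_eq_single i (fun j _ hj => by simp [hj]) (by simp)]
          simp
        exact congrArg Subtype.val this
      · obtain ⟨k, t, rfl⟩ := Set.mem_iUnion.1 hg
        refine ⟨(0, Pi.single k t.toAdd), ?_⟩
        have : Ψ (0, Pi.single k t.toAdd) = φ' k t := by
          simp only [Ψ, Pi.zero_apply, zpow_zero, Finset.prod_const_one, one_mul]
          rw [Finset.prod_eq_single k (fun j _ hj => by simp [hj]) (by simp)]
          simp
        exact congrArg Subtype.val this
    | one => exact ⟨0, congrArg Subtype.val hzero⟩
    | mul g h _ _ hg hh =>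
      obtain ⟨a, rfl⟩ := hg
      obtain ⟨b, rfl⟩ := hh
      exact ⟨a + b, congrArg Subtype.val (hadd a b)⟩
    | inv g _ hg =>
      obtain ⟨a, rfl⟩ := hg
      have h : Ψ (-a) = (Ψ a)⁻¹ := by
        rw [eq_inv_iff_mul_eq_one, ← hadd, neg_add_cancel, hzero]
      exact ⟨-a, congrArg Subtype.val h⟩

theorem theorem1 {d : ℕ} (G : Subgroup (FormalDiff d))
    (hcomm : ∀ g ∈ G, ∀ h ∈ G, g * h = h * g)
    (hfg : IsFinitelyGeneratedByMapsAndFlows G)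
    (X Y : FormalSubvariety d) :
    ∃ m : ℕ, ∀ g ∈ G,
      intersectionMultiplicity (X.preimage g) Y < ⊤ →
        intersectionMultiplicity (X.preimage g) Y ≤ (m : ℕ∞) := by
  obtain ⟨Λ, R, Ψ, hR, hΨ, hsurj⟩ := exists_isRegularFamily_of_finitelyGenerated hcomm hfg
  obtain ⟨m, hm⟩ := hΨ.exists_multiplicity_bound hR X Y
  refine ⟨m, fun g hg => ?_⟩
  obtain ⟨a, rfl⟩ := hsurj g hg
  exact hm a
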